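/- Let $\mathbb L$ be the square lattice or the hexagonal lattice, embedded in $\mathbb R^2$ as a regular tessellation with unit edges, with a site (the origin $o$) at $0$ and with some edges parallel to a coordinate axis; let $V$ be its set of sites and $p_c=\sup\{p\in[0,1]:\theta(p)=0\}$, where $\theta(p)$ is the probability that $o$ lies in an infinite open cluster in independent site percolation of density $p$ on $\mathbb L$. An enhancement is a family of maps $\phi_x$ ($x\in V$) from subsets of $V$ to subsets of $V$ such that, for some $R_0<\infty$ and all $x,\omega$, $\phi_x(\omega)$ depends only on $\omega\cap\{y:|y-x|\le R_0\}$ and is contained in $\{y:|y-x|\le R_0\}$, and such that $\phi_{x+t}(\omega)=t+\phi_x(\omega-t)$ for every translation $t$ preserving $\mathbb L$. It is monotonic if $\omega\subset\omega'$ implies $\phi_x(\omega)\subset\phi_x(\omega')$ for all $x$. It is essential if there are a site $x$ and a set $\omega\subset V$ such that $\omega$ contains no doubly-infinite self-repelling path but $\omega\cup\phi_x(\omega)$ does (a path is self-repelling if each of its sites is adjacent in $\mathbb L$ to no site of the path other than its neighbors in the path); otherwise it is nonessential. For $s\in[0,1]$, the enhanced configuration is $\hat\omega=\omega\cup\bigcup_{x\in\alpha}\phi_x(\omega)$,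 where $\omega$ is the set of open sites of independent site percolation with density $p_c$ and $\alpha$ is an independent random set of sites that contains each site independently with probability $s$. For $\delta,b,h>0$, a set $\omega$ of sites has a vertical crossing of ${\cal R}(b,h)=(-b/2,b/2)\times(-h/2,h/2)$ at mesh $\delta$ if there is an $\mathbb L$-path $(x_0,x_1,\dots,x_{m+1})$ of sites of $\omega$ with $\delta x_1,\dots,\delta x_m\in{\cal R}(b,h)$ such that the segment from $\delta x_0$ to $\delta x_1$ touches the top side $[-b/2,b/2]\times\{h/2\}$ and the segment from $\delta x_m$ to $\delta x_{m+1}$ touches the bottom side $[-b/2,b/2]\times\{-h/2\}$. Let $\varphi_\delta(b,h)$ and $\hat\varphi_\delta(b,h)$ be the probabilities that $\omega$ and $\hat\omega$, respectively, have such a crossing. Theorem. Assume that there is a continuous function $F:(0,\infty)\to\mathbb R$ such that $\lim_{\delta\downarrow0}\varphi_\delta(b,h)=F(b/h)$ for all $b,h>0$. Then, for every monotonic nonessential enhancement and every $s\in[0,1]$, $\lim_{\delta\downarrow0}\hat\varphi_\delta(b,h)=F(b/h)$ for all $b,h>0$. -/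

import Mathlib

open Set Filter Topology MeasureTheory ProbabilityTheory unitInterval

namespace EnhPerc

/-- The planar lattices under consideration, as regular tessellations of the plane with unit edges
and with a site at the origin: the square lattice `ℤ²`, and the hexagonal lattice in each of its two
positions relative to the coordinate axes (some edges vertical, or some edges horizontal). -/
inductive Lattice
  | square
  | hexagonal
  | hexagonalRotated

/-- The index set of the sites of each lattice.  For the hexagonal lattice this is the "brick wall"
representation: `(i, j)` is joined to `(i ± 1, j)`, and to `(i, j + 1)` if `i + j` is even, and
to `(i, j - 1)` if `i + j` is odd. -/
abbrev Site : Type := ℤ × ℤ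

/-- Positions of the sites of the hexagonal lattice in which some edges are vertical. -/
noncomputable def hexPos (x : Site) : EuclideanSpace ℝ (Fin 2) :=
  !₂[(x.1 : ℝ) * (Real.sqrt 3 / 2),
     (x.2 : ℝ) * (3 / 2) - if Even (x.1 + x.2) then 0 else 1 / 2]

/-- The position in the plane of a site. The second position of the hexagonal lattice is obtained by
exchanging the coordinates, which is a rotation by a right angle up to a symmetry of the lattice. -/
noncomputable def Lattice.pos : Lattice → Site → EuclideanSpace ℝ (Fin 2)
  | .square, x => !₂[(x.1 : ℝ), (x.2 : ℝ)]
  | .hexagonal, x => hexPos x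
  | .hexagonalRotated, x => !₂[hexPos x 1, hexPos x 0]

/-- The square lattice graph. -/
def squareGraph : SimpleGraph Site where
  Adj x y := (x.2 = y.2 ∧ (y.1 = x.1 + 1 ∨ x.1 = y.1 + 1)) ∨
    (x.1 = y.1 ∧ (y.2 = x.2 + 1 ∨ x.2 = y.2 + 1))
  symm := ⟨fun x y h => by omega⟩
  loopless := ⟨fun x h => by omega⟩

/-- The hexagonal lattice graph. -/
def hexGraph : SimpleGraph Site where
  Adj x y := (x.2 = y.2 ∧ (y.1 = x.1 + 1 ∨ x.1 = y.1 + 1)) ∨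
    (x.1 = y.1 ∧ ((y.2 = x.2 + 1 ∧ Even (x.1 + x.2)) ∨ (x.2 = y.2 + 1 ∧ Even (y.1 + y.2))))
  symm := ⟨fun x y h => by
    rcases h with ⟨h, h'⟩ | ⟨h, h'⟩
    · exact Or.inl ⟨h.symm, h'.symm⟩
    · exact Or.inr ⟨h.symm, h'.symm⟩⟩
  loopless := ⟨fun x h => by omega⟩

/-- The graph of nearest neighbours of a lattice (its edges join the sites at distance one). -/
def Lattice.graph : Lattice → SimpleGraph Site
  | .square => squareGraph
  | .hexagonal => hexGraph
  | .hexagonalRotated => hexGraph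

/-- The translations (in terms of the site indices) that preserve the lattice. The hexagonal lattice
has two classes of sites modulo translations, according to the parity of `i + j`. -/
def Lattice.translations : Lattice → Set Site
  | .square => univ
  | .hexagonal => {t | Even (t.1 + t.2)}
  | .hexagonalRotated => {t | Even (t.1 + t.2)}

/-! ### Independent site percolation -/

/-- The law of the set of open sites in independent site percolation of density `p`. -/
noncomputable def sitePercolation (p : I) : Measure (Set Site) := setBernoulli univ p

/-- The open cluster of the site `x` in the configuration `ω`: the sites that are joined to `x` by a
path of open sites. It is empty if `x` is closed. -/
def openCluster (L : Lattice) (ω : Set Site) (x : Site) : Set Site :=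
  {y | ∃ w : L.graph.Walk x y, ∀ z ∈ w.support, z ∈ ω}

/-- The percolation probability: the probability that the origin is in an infinite open cluster. -/
noncomputable def percolationProb (L : Lattice) (p : I) : ℝ :=
  (sitePercolation p).real {ω | (openCluster L ω 0).Infinite}

/-- The critical probability of independent site percolation. -/
noncomputable def criticalProb (L : Lattice) : I := sSup {p : I | percolationProb L p = 0}

/-! ### Enhancements -/

/-- An enhancement: a family of maps `φ x` on configurations, indexed by the sites, that is local
with a finite range and covariant under the translations of the lattice. On the square lattice,
covariance says that `φ x ω = x + φ 0 (τ_x ω)` with `y ∈ τ_x ω ↔ y + x ∈ ω`. -/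
structure Enhancement (L : Lattice) where
  /-- the sites that are opened when the enhancement is activated at a given site -/
  φ : Site → Set Site → Set Site
  exists_range : ∃ R₀ : ℝ, ∀ x : Site,
    (∀ ω ω' : Set Site, (∀ y, dist (L.pos y) (L.pos x) ≤ R₀ → (y ∈ ω ↔ y ∈ ω')) →
      φ x ω = φ x ω') ∧
    ∀ ω : Set Site, ∀ y ∈ φ x ω, dist (L.pos y) (L.pos x) ≤ R₀
  covariant : ∀ t ∈ L.translations, ∀ (x : Site) (ω : Set Site),
    φ (t + x) ω = (fun y => t + y) '' φ x ((fun y => t + y) ⁻¹' ω)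

/-- Monotonic enhancements: more open sites can only produce more open sites. -/
def Enhancement.Monotonic {L : Lattice} (E : Enhancement L) : Prop :=
  ∀ (x : Site) (ω ω' : Set Site), ω ⊆ ω' → E.φ x ω ⊆ E.φ x ω'

/-- The configuration `ω` contains a doubly-infinite self-repelling path: a doubly-infinite path
without repeated sites, none of whose sites is adjacent to a site of the path other than its two
neighbours in the path. -/
def HasDoublyInfinitePath (L : Lattice) (ω : Set Site) : Prop :=
  ∃ γ : ℤ → Site, Function.Injective γ ∧ (∀ i, γ i ∈ ω) ∧
    ∀ i j, L.graph.Adj (γ i) (γ j) ↔ (j = i + 1 ∨ i = j + 1)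

/-- Essential enhancements: for some configuration without a doubly-infinite self-repelling path,
activating the enhancement at a single site produces such a path. By covariance, only one site in
each class of sites modulo translations matters (on the square lattice, only the origin). -/
def Enhancement.Essential {L : Lattice} (E : Enhancement L) : Prop :=
  ∃ (x : Site) (ω : Set Site), ¬ HasDoublyInfinitePath L ω ∧ HasDoublyInfinitePath L (ω ∪ E.φ x ω)

/-- The enhanced configuration, where `α` is the set of sites at which the enhancement is
activated. -/
def Enhancement.enhanced {L : Lattice} (E : Enhancement L) (ω α : Set Site) : Set Site :=
  ω ∪ ⋃ x ∈ α, E.φ x ω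

/-! ### Crossing probabilities -/

/-- The open rectangle `(-b/2, b/2) × (-h/2, h/2)`. -/
def rect (b h : ℝ) : Set (EuclideanSpace ℝ (Fin 2)) :=
  {u | -(b / 2) < u 0 ∧ u 0 < b / 2 ∧ -(h / 2) < u 1 ∧ u 1 < h / 2}

/-- The horizontal segment `[-b/2, b/2] × {c}`. -/
def hside (b c : ℝ) : Set (EuclideanSpace ℝ (Fin 2)) :=
  {u | -(b / 2) ≤ u 0 ∧ u 0 ≤ b / 2 ∧ u 1 = c}

/-- There is an open vertical crossing of the rectangle in the configuration `ω` on the lattice with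
mesh `δ`: a path `x 0, …, x (m + 1)` of open sites whose sites other than the two ends lie in
the rectangle, and whose first and last edges touch its top and its bottom side. -/
def HasVerticalCrossing (L : Lattice) (δ b h : ℝ) (ω : Set Site) : Prop :=
  ∃ (m : ℕ) (x : ℕ → Site),
    (∀ j ≤ m, L.graph.Adj (x j) (x (j + 1))) ∧
    (∀ j ≤ m + 1, x j ∈ ω) ∧
    (∀ j, 1 ≤ j → j ≤ m → δ • L.pos (x j) ∈ rect b h) ∧
    (segment ℝ (δ • L.pos (x 0)) (δ • L.pos (x 1)) ∩ hside b (h / 2)).Nonempty ∧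
    (segment ℝ (δ • L.pos (x m)) (δ • L.pos (x (m + 1))) ∩ hside b (-(h / 2))).Nonempty

/-- The crossing probability of the rectangle in critical independent site percolation. -/
noncomputable def crossingProb (L : Lattice) (δ b h : ℝ) : ℝ :=
  (sitePercolation (criticalProb L)).real {ω | HasVerticalCrossing L δ b h ω}

/-- The crossing probability of the rectangle after an enhancement with density `s` of critical
independent site percolation: `ω` and the set `α` of activated sites are independent. -/
noncomputable def enhancedCrossingProb (L : Lattice) (E : Enhancement L) (s : I) (δ b h : ℝ) : ℝ :=
  ((sitePercolation (criticalProb L)).prod (sitePercolation s)).real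
    {c | HasVerticalCrossing L δ b h (E.enhanced c.1 c.2)}

end EnhPerc

/-!
A nonessential monotonic enhancement can only enlarge a crossed rectangle by a bounded number of
lattice spacings, and this is a deterministic fact (`EnhPerc.hasVerticalCrossing_of_enhanced`).

Suppose that the enhancement of `ω` crosses a rectangle. Let `ω'` consist of the sites of `ω` in a
slightly larger rectangle, of a ray going up from the first site of the crossing, and of a ray going
down from its last site. By locality and monotonicity, the enhancement of `ω'` at finitely many sites
still contains the crossing, together with the two rays. A shortest path between far sites of the two
rays, continued along the rays, is then a doubly-infinite self-repelling path
(`EnhPerc.exists_doublyInfinite_of_rays`). Since the enhancement is nonessential and monotonic, its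
activations can be removed one by one, and `ω'` itself contains a doubly-infinite self-repelling path
(`EnhPerc.Enhancement.hasDoublyInfinitePath_of_enhanced`). The two ends of this path cannot escape
along the same ray (`EnhPerc.exists_notMem_union_ray`), so the path connects the two rays, and
between them it uses sites of `ω`: it contains a crossing by `ω` of every slightly wider and lower
rectangle, if the mesh is small.

Consequently, for `b < b'` and `h' < h`, the enhanced crossing probability of the rectangle of sides
`b` and `h` is, for small mesh, between the original crossing probabilities of the rectangles of sides
`b`, `h` and of sides `b'`, `h'`. The continuity of the limit as a function of the aspect ratio
concludes.
-/

namespace EnhPerc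

/-! ### Doubly-infinite paths and rays in graphs with a level function -/

section Levels

variable {V : Type*} {G : SimpleGraph V} {ℓ : V → ℤ} {u d : ℕ → V} {K : Set V}

/-- The sequence `u` is a path in `G` along which the level `ℓ` increases by one at each step. -/
def IsRay (G : SimpleGraph V) (ℓ : V → ℤ) (u : ℕ → V) : Prop :=
  ∀ n, G.Adj (u n) (u (n + 1)) ∧ ℓ (u (n + 1)) = ℓ (u n) + 1

lemma IsRay.level (hu : IsRay G ℓ u) (n : ℕ) : ℓ (u n) = ℓ (u 0) + n := by
  induction n with
  | zero => simp
  | succ k ih => rw [(hu k).2, ih]; push_cast; ring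

lemma exists_eq_of_step_le {f : ℕ → ℤ} {c : ℤ} {n : ℕ} (hf : ∀ j < n, f (j + 1) ≤ f j + 1)
    (h0 : f 0 ≤ c) (hn : c ≤ f n) : ∃ j ≤ n, f j = c := by
  induction n with
  | zero => exact ⟨0, le_rfl, le_antisymm h0 hn⟩
  | succ k ih =>
    rcases le_or_gt c (f k) with h | h
    · obtain ⟨j, hj, hc⟩ := ih (fun j hj => hf j (by omega)) h
      exact ⟨j, by omega, hc⟩
    · exact ⟨k + 1, le_rfl, by have := hf k (by omega); omega⟩

/-- Only finitely many sites of a ray are below a given level, so an injective path that stays in a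
ray and a finite set has to climb the ray. -/
lemma exists_level_eq_of_injective (hℓ : ∀ x y, G.Adj x y → |ℓ x - ℓ y| ≤ 1) (hu : IsRay G ℓ u)
    (hK : K.Finite) {c : ℤ} (hKc : ∀ x ∈ K, ℓ x < c) {g : ℕ → V} (hg : Function.Injective g)
    (hadj : ∀ n, G.Adj (g n) (g (n + 1))) (hmem : ∀ n, g n ∈ K ∪ range u) (h0 : ℓ (g 0) < c) :
    ∃ n, ℓ (g n) = c ∧ g n = u (c - ℓ (u 0)).toNat := by
  have hfin : (K ∪ u '' {n | n ≤ (c - ℓ (u 0)).toNat}).Finite :=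
    hK.union ((finite_le_nat _).image u)
  obtain ⟨n, hn⟩ : ∃ n, g n ∉ K ∪ u '' {n | n ≤ (c - ℓ (u 0)).toNat} := by
    by_contra! h
    exact (infinite_range_of_injective hg) (hfin.subset (range_subset_iff.2 h))
  have hcn : c ≤ ℓ (g n) := by
    rcases hmem n with h | ⟨m, hm⟩
    · exact (hn (Or.inl h)).elim
    · have : ¬ m ≤ (c - ℓ (u 0)).toNat := fun h => hn (Or.inr ⟨m, h, hm⟩)
      rw [← hm, hu.level]
      omega
  obtain ⟨j, -, hj⟩ := exists_eq_of_step_le (f := fun n => ℓ (g n)) (c := c) (n := n)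
    (fun j _ => by have := abs_le.1 (hℓ _ _ (hadj j)); omega) h0.le hcn
  refine ⟨j, hj, ?_⟩
  rcases hmem j with h | ⟨m, hm⟩
  · exact ((hKc _ h).ne hj).elim
  · rw [← hm, hu.level] at hj
    rw [← hm]
    congr
    omega

/-- The two ends of a doubly-infinite path cannot escape to infinity along the same ray, since the
ray has only one site at each level. -/
lemma exists_notMem_union_ray (hℓ : ∀ x y, G.Adj x y → |ℓ x - ℓ y| ≤ 1) (hu : IsRay G ℓ u)
    (hK : K.Finite) {γ : ℤ → V} (hγ : Function.Injective γ)
    (hadj : ∀ n, G.Adj (γ n) (γ (n + 1))) : ∃ n, γ n ∉ K ∪ range u := by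
  by_contra! hmem
  obtain ⟨c, hc⟩ : ∃ c, ∀ x ∈ insert (γ 0) K, ℓ x < c := by
    obtain ⟨c, hc⟩ := ((hK.insert (γ 0)).image ℓ).bddAbove
    exact ⟨c + 1, fun x hx => Int.lt_add_one_of_le (hc ⟨x, hx, rfl⟩)⟩
  have hKc : ∀ x ∈ K, ℓ x < c := fun x hx => hc x (Or.inr hx)
  have h0 := hc (γ 0) (Or.inl rfl)
  obtain ⟨n, hn, hn'⟩ := exists_level_eq_of_injective hℓ hu hK hKc (g := fun n : ℕ => γ n)
    (fun i j h => by simpa using hγ h) (fun n => by simpa using hadj n) (fun n => hmem n)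
    (by simpa using h0)
  obtain ⟨m, hm, hm'⟩ := exists_level_eq_of_injective hℓ hu hK hKc (g := fun n : ℕ => γ (-n))
    (fun i j h => by simpa using hγ h)
    (fun n => by
      have := (hadj (-(n + 1 : ℤ))).symm
      push_cast
      rwa [show -(n + 1 : ℤ) + 1 = -n by ring] at this)
    (fun n => hmem _) (by simpa using h0)
  have := hγ (hn'.trans hm'.symm)
  obtain rfl : n = 0 := by omega
  exact h0.ne hn

/-- A finite path without repetitions that starts at a site which is the only one of its level does
not return to that level. -/
lemma level_lt_of_path (hℓ : ∀ x y, G.Adj x y → |ℓ x - ℓ y| ≤ 1) {g : ℕ → V} {k : ℕ}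
    (hg : ∀ i ≤ k, g i = g 0 → i = 0) (hadj : ∀ i < k, G.Adj (g i) (g (i + 1)))
    (huniq : ∀ i ≤ k, ℓ (g i) = ℓ (g 0) → g i = g 0) (hk : ℓ (g k) < ℓ (g 0))
    {i : ℕ} (hi : 0 < i) (hik : i ≤ k) : ℓ (g i) < ℓ (g 0) := by
  by_contra! h
  obtain ⟨j, hj, hjc⟩ := exists_eq_of_step_le (f := fun j => -ℓ (g (i + j))) (c := -ℓ (g 0))
    (n := k - i)
    (fun j hj => by
      have := abs_le.1 (hℓ _ _ (hadj (i + j) (by omega)))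
      rw [← add_assoc]
      omega)
    (by simpa using h) (by rw [Nat.add_sub_cancel' hik]; omega)
  have := hg (i + j) (by omega) (huniq (i + j) (by omega) (by simpa using hjc))
  omega

/-- A shortest walk between two vertices is an induced path. -/
lemma eq_succ_of_adj_getVert {x y : V} (w : G.Walk x y) (hw : w.length = G.dist x y) {i j : ℕ}
    (hij : i < j) (hj : j ≤ w.length) (h : G.Adj (w.getVert i) (w.getVert j)) : j = i + 1 := by
  have := G.dist_le ((w.take i).append (.cons h (w.drop j)))
  simp only [SimpleGraph.Walk.length_append, SimpleGraph.Walk.length_cons,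
    SimpleGraph.Walk.take_length, SimpleGraph.Walk.drop_length] at this
  omega

lemma reachable_induce {S : Set V} {g : ℕ → V} {m : ℕ} (hgS : ∀ i ≤ m, g i ∈ S)
    (hg : ∀ i < m, G.Adj (g i) (g (i + 1))) :
    (G.induce S).Reachable ⟨g 0, hgS 0 (Nat.zero_le m)⟩ ⟨g m, hgS m le_rfl⟩ := by
  induction m with
  | zero => rfl
  | succ m ih =>
    refine (ih (fun i hi => hgS i (by omega)) (fun i hi => hg i (by omega))).trans
      (SimpleGraph.Adj.reachable ?_)
    exact hg m (by omega)

/-- The sites of an ascending and a descending ray, together with a finite path that connects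
them, contain a doubly-infinite self-repelling path: it consists of a shortest path between a far
site of the first ray and a far site of the second one, and of the tails of the two rays. -/
lemma exists_doublyInfinite_of_rays (hℓ : ∀ x y, G.Adj x y → |ℓ x - ℓ y| ≤ 1) (hu : IsRay G ℓ u)
    (hd : IsRay G (fun x => -ℓ x) d) {g : ℕ → V} {m : ℕ}
    (hg : ∀ i < m, G.Adj (g i) (g (i + 1))) (hu0 : u 0 = g 0) (hd0 : d 0 = g m) :
    ∃ γ : ℤ → V, Function.Injective γ ∧ (∀ i, γ i ∈ g '' Iic m ∪ range u ∪ range d) ∧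
      ∀ i j, G.Adj (γ i) (γ j) ↔ (j = i + 1 ∨ i = j + 1) := by
  obtain ⟨K, hKg⟩ : ∃ K, K = g '' Iic m := ⟨_, rfl⟩
  have hK : K.Finite := hKg ▸ (finite_Iic m).image g
  obtain ⟨S, hS⟩ : ∃ S, S = K ∪ range u ∪ range d := ⟨_, rfl⟩
  have hgS : ∀ i ≤ m, g i ∈ S := fun i hi => hS ▸ Or.inl (Or.inl (hKg ▸ ⟨i, hi, rfl⟩))
  rw [← hKg, ← hS]
  have hdl : ∀ n, ℓ (d n) = ℓ (d 0) - n := fun n => by have := hd.level n; omega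
  have hul := hu.level
  have huS : ∀ n, u n ∈ S := fun n => hS ▸ Or.inl (Or.inr ⟨n, rfl⟩)
  have hdS : ∀ n, d n ∈ S := fun n => hS ▸ Or.inr ⟨n, rfl⟩
  obtain ⟨M, hM⟩ : ∃ M : ℕ, ∀ x ∈ insert (u 0) (insert (d 0) K), |ℓ x| < M := by
    obtain ⟨c, hc⟩ := (((hK.insert (d 0)).insert (u 0)).image (fun x => |ℓ x|)).bddAbove
    exact ⟨c.toNat + 1, fun x hx => by
      have : |ℓ x| ≤ c := hc ⟨x, hx, rfl⟩
      push_cast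
      omega⟩
  have hMu := abs_lt.1 (hM (u 0) (by simp))
  have hMd := abs_lt.1 (hM (d 0) (by simp))
  have hMK : ∀ x ∈ K, |ℓ x| < M := fun x hx => hM x (by simp [hx])
  -- Beyond the levels `M` and `-M` there is only one site of `S` at each level.
  set a := 2 * M with ha
  set b := 2 * M with hb
  have hupper : ∀ x ∈ S, ℓ x = ℓ (u a) → x = u a := by
    intro x hx hxa
    rw [hul] at hxa
    rw [hS] at hx
    rcases hx with (hx | ⟨n, rfl⟩) | ⟨n, rfl⟩
    · have := abs_lt.1 (hMK x hx); omega
    · rw [hul] at hxa; congr 1; omega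
    · rw [hdl] at hxa; omega
  have hlower : ∀ x ∈ S, ℓ x = ℓ (d b) → x = d b := by
    intro x hx hxa
    rw [hdl] at hxa
    rw [hS] at hx
    rcases hx with (hx | ⟨n, rfl⟩) | ⟨n, rfl⟩
    · have := abs_lt.1 (hMK x hx); omega
    · rw [hul] at hxa; omega
    · rw [hdl] at hxa; congr 1; omega
  have hreach : (G.induce S).Reachable ⟨u a, huS a⟩ ⟨d b, hdS b⟩ := by
    have h1 := reachable_induce (g := u) (m := a) (fun i _ => huS i) (fun i _ => (hu i).1)
    have h2 := reachable_induce (g := d) (m := b) (fun i _ => hdS i) (fun i _ => (hd i).1)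
    have h3 := reachable_induce hgS hg
    simp only [← hu0, ← hd0] at h3
    exact (h1.symm.trans h3).trans h2
  obtain ⟨w, hw⟩ := hreach.exists_walk_length_eq_dist
  have hpath := w.isPath_of_length_eq_dist hw
  set k := w.length with hk
  set p : ℕ → V := fun n => (w.getVert n : V) with hp
  have hpS : ∀ n, p n ∈ S := fun n => (w.getVert n).2
  have hp0 : p 0 = u a := by simp [hp]
  have hpk : p k = d b := by simp [hp, hk]
  have hpadj : ∀ n < k, G.Adj (p n) (p (n + 1)) := fun n hn => w.adj_getVert_succ hn
  have hpind : ∀ i j, i < j → j ≤ k → G.Adj (p i) (p j) → j = i + 1 := fun i j hij hj h =>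
    eq_succ_of_adj_getVert w hw hij hj h
  have hpinj : ∀ i ≤ k, ∀ j ≤ k, p i = p j → i = j := fun i hi j hj h =>
    hpath.getVert_injOn hi hj (Subtype.ext h)
  have hlt : ℓ (p k) < ℓ (p 0) := by rw [hp0, hpk, hul, hdl]; omega
  have hptop : ∀ i, 0 < i → i ≤ k → ℓ (p i) < ℓ (u a) := fun i hi hik => hp0 ▸
    level_lt_of_path hℓ (fun i hi h => hpinj i hi 0 (by omega) h) hpadj
      (fun i _ h => by rw [hp0] at h ⊢; exact hupper _ (hpS i) h) hlt hi hik
  have hpbot : ∀ i < k, ℓ (d b) < ℓ (p i) := by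
    intro i hi
    have hℓ' : ∀ x y, G.Adj x y → |(-ℓ x) - (-ℓ y)| ≤ 1 := fun x y h => by
      have := hℓ y x h.symm
      rwa [show -ℓ x - -ℓ y = ℓ y - ℓ x by ring]
    have := level_lt_of_path (ℓ := fun x => -ℓ x) (g := fun i => p (k - i)) (k := k) hℓ'
      (fun i hi h => by have := hpinj _ (by omega) _ (by omega) h; omega)
      (fun i hi => by
        have := (hpadj (k - (i + 1)) (by omega)).symm
        rwa [show k - (i + 1) + 1 = k - i by omega] at this)
      (fun i _ h => by
        simp only [Nat.sub_zero, hpk, neg_inj] at h ⊢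
        exact hlower _ (hpS _) h)
      (by simpa using hlt) (i := k - i) (by omega) (by omega)
    simp only [Nat.sub_zero, hpk, Nat.sub_sub_self hi.le] at this
    omega
  have hk0 : 0 < k := by
    rcases Nat.eq_zero_or_pos k with h | h
    · rw [h] at hlt; exact (lt_irrefl _ hlt).elim
    · exact h
  set γ : ℤ → V := fun n => if n < 0 then u (a + (-n).toNat) else
    if n ≤ k then p n.toNat else d (b + (n - k).toNat) with hγ
  have γneg : ∀ n : ℤ, n ≤ 0 → γ n = u (a + (-n).toNat) := by
    intro n hn
    rcases hn.lt_or_eq with h | rfl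
    · simp [hγ, h]
    · simp [hγ, hp0]
  have γmid : ∀ n : ℤ, 0 ≤ n → n ≤ k → γ n = p n.toNat := fun n h h' => by
    simp [hγ, h', not_lt.2 h]
  have γpos : ∀ n : ℤ, k ≤ n → γ n = d (b + (n - k).toNat) := by
    intro n hn
    rcases hn.lt_or_eq with h | rfl
    · simp [hγ, not_le.2 h, not_lt.2 ((Nat.cast_nonneg k).trans hn)]
    · simp [hγ, hpk]
  have lneg : ∀ n : ℤ, n ≤ 0 → ℓ (γ n) = ℓ (u a) - n := fun n hn => by
    rw [γneg n hn, hul, hul a]; omega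
  have lpos : ∀ n : ℤ, k ≤ n → ℓ (γ n) = ℓ (d b) - (n - k) := fun n hn => by
    rw [γpos n hn, hdl, hdl b]; omega
  have ltop : ∀ n : ℤ, 0 < n → ℓ (γ n) < ℓ (u a) := by
    intro n hn
    rcases le_total n k with h | h
    · rw [γmid n hn.le h]
      exact hptop _ (by omega) (by omega)
    · rw [lpos n h, ← hp0, ← hpk]; omega
  have lbot : ∀ n : ℤ, n < k → ℓ (d b) < ℓ (γ n) := by
    intro n hn
    rcases le_total 0 n with h | h
    · rw [γmid n h hn.le]
      exact hpbot _ (by omega)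
    · rw [lneg n h, ← hp0, ← hpk]; omega
  have hsucc : ∀ n, G.Adj (γ n) (γ (n + 1)) := by
    intro n
    rcases lt_or_ge n 0 with h | h
    · rw [γneg n h.le, γneg (n + 1) (by omega)]
      have := (hu (a + (-(n + 1)).toNat)).1.symm
      rwa [show a + (-(n + 1)).toNat + 1 = a + (-n).toNat by omega] at this
    rcases lt_or_ge n k with h' | h'
    · rw [γmid n h h'.le, γmid (n + 1) (by omega) (by omega),
        show (n + 1).toNat = n.toNat + 1 by omega]
      exact hpadj _ (by omega)
    · rw [γpos n h', γpos (n + 1) (by omega),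
        show b + (n + 1 - k).toNat = b + (n - k).toNat + 1 by omega]
      exact (hd _).1
  have hlt_adj : ∀ i j, i < j → G.Adj (γ i) (γ j) → j = i + 1 := by
    intro i j hij h
    have hle := abs_le.1 (hℓ _ _ h)
    rcases lt_or_ge i 0 with hi | hi
    · rcases le_or_gt j 0 with hj | hj
      · rw [lneg i hi.le, lneg j hj] at hle; omega
      · have := ltop j hj
        rw [lneg i hi.le] at hle; omega
    rcases le_or_gt j k with hj | hj
    · rw [γmid i hi (by omega), γmid j (by omega) hj] at h
      have := hpind _ _ (by omega) (by omega) h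
      omega
    · rcases lt_or_ge i k with hi' | hi'
      · have := lbot i hi'
        rw [lpos j hj.le] at hle; omega
      · rw [lpos i hi', lpos j hj.le] at hle; omega
  have hiff : ∀ i j, G.Adj (γ i) (γ j) ↔ (j = i + 1 ∨ i = j + 1) := by
    intro i j
    constructor
    · intro h
      rcases lt_trichotomy i j with hij | rfl | hij
      · exact Or.inl (hlt_adj i j hij h)
      · exact (G.irrefl h).elim
      · exact Or.inr (hlt_adj j i hij h.symm)
    · rintro (rfl | rfl)
      · exact hsucc i
      · exact (hsucc j).symm
  refine ⟨γ, fun i j hij => ?_, fun i => ?_, hiff⟩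
  · -- Two equal sites have the same neighbours in the path.
    have h1 := (hiff j (i + 1)).1 (hij ▸ hsucc i)
    have h2 := (hiff i (j + 1)).1 (hij ▸ hsucc j)
    omega
  · simp only [hγ]
    split_ifs
    exacts [huS _, hpS _, hdS _]

end Levels

/-! ### Levels, rays and positions of the sites of the lattices -/

/-- An integer-valued function on the sites that changes by at most one along the edges, and that
increases upwards in the plane along suitable paths. -/
def Lattice.level : Lattice → Site → ℤ
  | .square, x => x.2
  | .hexagonal, x => x.1 + x.2
  | .hexagonalRotated, x => x.1

/-- A neighbour of the given site at the next level, not lower in the plane. -/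
def Lattice.up : Lattice → Site → Site
  | .square, x => (x.1, x.2 + 1)
  | .hexagonal, x => if Even (x.1 + x.2) then (x.1, x.2 + 1) else (x.1 + 1, x.2)
  | .hexagonalRotated, x => (x.1 + 1, x.2)

/-- A neighbour of the given site at the previous level, not higher in the plane. -/
def Lattice.down : Lattice → Site → Site
  | .square, x => (x.1, x.2 - 1)
  | .hexagonal, x => if Even (x.1 + x.2) then (x.1 - 1, x.2) else (x.1, x.2 - 1)
  | .hexagonalRotated, x => (x.1 - 1, x.2)

lemma Lattice.abs_level_sub_le (L : Lattice) (x y : Site) (h : L.graph.Adj x y) :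
    |L.level x - L.level y| ≤ 1 := by
  rw [abs_le]
  cases L <;> simp only [Lattice.graph, squareGraph, hexGraph, Lattice.level] at h ⊢ <;> omega

lemma Lattice.adj_up (L : Lattice) (x : Site) : L.graph.Adj x (L.up x) := by
  cases L <;> simp only [Lattice.graph, squareGraph, hexGraph, Lattice.up]
  · simp
  · split_ifs with h <;> simp [h]
  · simp

lemma Lattice.adj_down (L : Lattice) (x : Site) : L.graph.Adj x (L.down x) := by
  cases L <;> simp only [Lattice.graph, squareGraph, hexGraph, Lattice.down]
  · simp
  · split_ifs with h
    · simp
    · have : Even (x.1 + (x.2 - 1)) := by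
        rw [← add_sub_assoc, Int.even_sub_one]; exact h
      simp [this]
  · simp

lemma Lattice.level_up (L : Lattice) (x : Site) : L.level (L.up x) = L.level x + 1 := by
  cases L <;> simp only [Lattice.level, Lattice.up]
  split_ifs <;> dsimp only <;> ring

lemma Lattice.level_down (L : Lattice) (x : Site) : L.level (L.down x) = L.level x - 1 := by
  cases L <;> simp only [Lattice.level, Lattice.down]
  split_ifs <;> dsimp only <;> ring

lemma one_le_sqrt_three : 1 ≤ Real.sqrt 3 := by
  rw [Real.one_le_sqrt]; norm_num

lemma sqrt_three_le_two : Real.sqrt 3 ≤ 2 := by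
  rw [Real.sqrt_le_left (by norm_num)]; norm_num

lemma Lattice.pos_le_pos_up (L : Lattice) (x : Site) : L.pos x 1 ≤ L.pos (L.up x) 1 := by
  have h3 := one_le_sqrt_three
  cases L <;> simp only [Lattice.pos, Lattice.up, hexPos]
  · simp
  · by_cases h : Even (x.1 + x.2)
    · have : ¬ Even (x.1 + (x.2 + 1)) := by rw [← add_assoc, Int.even_add_one]; simpa using h
      simp [h, this]; linarith
    · have : Even (x.1 + 1 + x.2) := by rw [add_right_comm, Int.even_add_one]; exact h
      simp [h, this]
  · simp

lemma Lattice.pos_down_le_pos (L : Lattice) (x : Site) : L.pos (L.down x) 1 ≤ L.pos x 1 := by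
  have h3 := one_le_sqrt_three
  cases L <;> simp only [Lattice.pos, Lattice.down, hexPos]
  · simp
  · by_cases h : Even (x.1 + x.2)
    · have : ¬ Even (x.1 - 1 + x.2) := by rw [sub_add_eq_add_sub, Int.even_sub_one]; simpa using h
      simp [h, this]
    · have : Even (x.1 + (x.2 - 1)) := by rw [← add_sub_assoc, Int.even_sub_one]; exact h
      simp [h, this]; linarith
  · simp

lemma abs_hexPos_sub_le (x y : Site) (h : hexGraph.Adj x y) (k : Fin 2) :
    |hexPos x k - hexPos y k| ≤ 1 := by
  have h3 := one_le_sqrt_three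
  have h3' := sqrt_three_le_two
  obtain ⟨x1, x2⟩ := x
  obtain ⟨y1, y2⟩ := y
  rw [abs_le]
  simp only [hexGraph] at h
  rcases h with ⟨rfl, rfl | rfl⟩ | ⟨rfl, ⟨rfl, he⟩ | ⟨rfl, he⟩⟩
  · fin_cases k
    · simp [hexPos]; constructor <;> linarith
    · simp only [hexPos]; split_ifs <;> simp <;> norm_num
  · fin_cases k
    · simp [hexPos]; constructor <;> linarith
    · simp only [hexPos]; split_ifs <;> simp <;> norm_num
  · have : ¬ Even (x1 + (x2 + 1)) := by rw [← add_assoc, Int.even_add_one]; simpa using he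
    fin_cases k
    · simp [hexPos]
    · simp [hexPos, he, this]; constructor <;> linarith
  · have : ¬ Even (x1 + (y2 + 1)) := by rw [← add_assoc, Int.even_add_one]; simpa using he
    fin_cases k
    · simp [hexPos]
    · simp [hexPos, he, this]; constructor <;> linarith

lemma Lattice.abs_pos_sub_le (L : Lattice) {x y : Site} (h : L.graph.Adj x y) (k : Fin 2) :
    |L.pos x k - L.pos y k| ≤ 1 := by
  cases L
  · obtain ⟨x1, x2⟩ := x
    obtain ⟨y1, y2⟩ := y
    simp only [Lattice.graph, squareGraph] at h
    rcases h with ⟨rfl, rfl | rfl⟩ | ⟨rfl, rfl | rfl⟩ <;> fin_cases k <;> simp [Lattice.pos]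
  · exact abs_hexPos_sub_le x y h k
  · fin_cases k
    · exact abs_hexPos_sub_le x y h 1
    · exact abs_hexPos_sub_le x y h 0

lemma abs_hexPos_bound (x : Site) :
    |(x.1 : ℝ)| ≤ 2 * |hexPos x 0| ∧ |(x.2 : ℝ)| ≤ |hexPos x 1| + 1 := by
  have h3 := one_le_sqrt_three
  constructor
  · have : |hexPos x 0| = |(x.1 : ℝ)| * (Real.sqrt 3 / 2) := by
      simp [hexPos, abs_mul, abs_div]
    rw [this]
    nlinarith [abs_nonneg (x.1 : ℝ)]
  · simp only [hexPos]
    split_ifs <;> simp <;> rw [abs_le] <;> constructor <;>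
      cases abs_cases (x.2 : ℝ) <;>
      first
        | (have := neg_abs_le ((x.2 : ℝ) * (3 / 2))
           have := le_abs_self ((x.2 : ℝ) * (3 / 2)); linarith)
        | (have := neg_abs_le ((x.2 : ℝ) * (3 / 2) - 2⁻¹)
           have := le_abs_self ((x.2 : ℝ) * (3 / 2) - 2⁻¹); linarith)

/-- A bounded region of the plane contains only finitely many sites. -/
lemma Lattice.finite_setOf_abs_pos_le (L : Lattice) (A B : ℝ) :
    {x : Site | |L.pos x 0| ≤ A ∧ |L.pos x 1| ≤ B}.Finite := by
  set N : ℤ := ⌈2 * |A| + 2 * |B| + 1⌉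
  refine ((finite_Icc (-N) N).prod (finite_Icc (-N) N)).subset ?_
  rintro x ⟨h0, h1⟩
  have hA := h0.trans (le_abs_self A)
  have hB := h1.trans (le_abs_self B)
  have hN : 2 * |A| + 2 * |B| + 1 ≤ N := Int.le_ceil _
  have key : |(x.1 : ℝ)| ≤ N ∧ |(x.2 : ℝ)| ≤ N := by
    have hA' := abs_nonneg A
    have hB' := abs_nonneg B
    cases L
    · simp only [Lattice.pos] at hA hB
      simp at hA hB
      constructor <;> linarith
    · have := abs_hexPos_bound x
      simp only [Lattice.pos] at hA hB
      constructor <;> linarith [this.1, this.2]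
    · have := abs_hexPos_bound x
      simp only [Lattice.pos] at hA hB
      simp at hA hB
      constructor <;> linarith [this.1, this.2]
  obtain ⟨k1, k2⟩ := key
  rw [abs_le] at k1 k2
  exact ⟨⟨by exact_mod_cast k1.1, by exact_mod_cast k1.2⟩,
    ⟨by exact_mod_cast k2.1, by exact_mod_cast k2.2⟩⟩

lemma Lattice.isRay_up (L : Lattice) (x : Site) : IsRay L.graph L.level (fun n => L.up^[n] x) :=
  fun n => by
    simp only [Function.iterate_succ_apply']
    exact ⟨L.adj_up _, L.level_up _⟩

lemma Lattice.isRay_down (L : Lattice) (x : Site) :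
    IsRay L.graph (fun y => -L.level y) (fun n => L.down^[n] x) :=
  fun n => by
    simp only [Function.iterate_succ_apply', L.level_down]
    exact ⟨L.adj_down _, by ring⟩

lemma Lattice.pos_le_pos_iterate_up (L : Lattice) (x : Site) (n : ℕ) :
    L.pos x 1 ≤ L.pos (L.up^[n] x) 1 := by
  induction n with
  | zero => rfl
  | succ n ih => rw [Function.iterate_succ_apply']; exact ih.trans (L.pos_le_pos_up _)

lemma Lattice.pos_iterate_down_le_pos (L : Lattice) (x : Site) (n : ℕ) :
    L.pos (L.down^[n] x) 1 ≤ L.pos x 1 := by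
  induction n with
  | zero => rfl
  | succ n ih => rw [Function.iterate_succ_apply']; exact (L.pos_down_le_pos _).trans ih

lemma HasDoublyInfinitePath.mono {L : Lattice} {ω ω' : Set Site} (h : ω ⊆ ω')
    (hω : HasDoublyInfinitePath L ω) : HasDoublyInfinitePath L ω' := by
  obtain ⟨γ, hinj, hmem, hadj⟩ := hω
  exact ⟨γ, hinj, fun i => h (hmem i), hadj⟩

/-- A configuration that contains a finite path together with the ray up from its first site and the
ray down from its last site contains a doubly-infinite self-repelling path. -/
lemma hasDoublyInfinitePath_of_path (L : Lattice) {S : Set Site} {n : ℕ} {x : ℕ → Site}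
    (hadj : ∀ j < n, L.graph.Adj (x j) (x (j + 1))) (hx : ∀ j ≤ n, x j ∈ S)
    (hup : ∀ m, L.up^[m] (x 0) ∈ S) (hdown : ∀ m, L.down^[m] (x n) ∈ S) :
    HasDoublyInfinitePath L S := by
  refine HasDoublyInfinitePath.mono ?_ (exists_doublyInfinite_of_rays L.abs_level_sub_le
    (L.isRay_up (x 0)) (L.isRay_down (x n)) hadj rfl rfl)
  rintro y ((⟨j, hj, rfl⟩ | ⟨m, rfl⟩) | ⟨m, rfl⟩)
  exacts [hx j hj, hup m, hdown m]

/-- A doubly-infinite path whose sites are in a finite set or on a ray up or on a ray down visits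
both rays. -/
lemma HasDoublyInfinitePath.exists_path {L : Lattice} {K : Set Site} (hK : K.Finite) {x y : Site}
    (h : HasDoublyInfinitePath L
      (K ∪ range (fun n => L.up^[n] x) ∪ range (fun n => L.down^[n] y))) :
    ∃ (n : ℕ) (z : ℕ → Site), (∀ j < n, L.graph.Adj (z j) (z (j + 1))) ∧
      (∀ j ≤ n, z j ∈ K ∪ range (fun n => L.up^[n] x) ∪ range (fun n => L.down^[n] y)) ∧
      z 0 ∈ range (fun n => L.up^[n] x) ∧ z n ∈ range (fun n => L.down^[n] y) := by
  obtain ⟨γ, hinj, hmem, hadj⟩ := h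
  have hsucc : ∀ n, L.graph.Adj (γ n) (γ (n + 1)) := fun n => (hadj n (n + 1)).2 (Or.inl rfl)
  obtain ⟨i, hi⟩ : ∃ i, γ i ∈ range (fun n => L.up^[n] x) := by
    obtain ⟨i, hi⟩ := exists_notMem_union_ray (ℓ := fun y => -L.level y)
      (fun x y h => by
        have := L.abs_level_sub_le y x h.symm
        rwa [show -L.level x - -L.level y = L.level y - L.level x by ring])
      (L.isRay_down y) hK hinj hsucc
    refine ⟨i, ?_⟩
    rcases hmem i with (h | h) | h
    exacts [(hi (Or.inl h)).elim, h, (hi (Or.inr h)).elim]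
  obtain ⟨k, hk⟩ : ∃ k, γ k ∈ range (fun n => L.down^[n] y) := by
    obtain ⟨k, hk⟩ := exists_notMem_union_ray L.abs_level_sub_le (L.isRay_up x) hK hinj hsucc
    refine ⟨k, ?_⟩
    rcases hmem k with h | h
    exacts [(hk h).elim, h]
  rcases le_total i k with hik | hik
  · refine ⟨(k - i).toNat, fun j => γ (i + j), fun j _ => ?_, fun j _ => hmem _, by simpa using hi, ?_⟩
    · simp only [Nat.cast_succ, ← add_assoc]
      exact hsucc _
    · simpa only [Int.toNat_of_nonneg (sub_nonneg.2 hik), add_sub_cancel] using hk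
  · refine ⟨(i - k).toNat, fun j => γ (i - j), fun j _ => ?_, fun j _ => hmem _, by simpa using hi, ?_⟩
    · have := (hsucc (i - (j + 1))).symm
      rw [show i - (j + 1 : ℤ) + 1 = i - j by ring] at this
      simpa only [Nat.cast_succ] using this
    · simpa only [Int.toNat_of_nonneg (sub_nonneg.2 hik), sub_sub_cancel] using hk

/-! ### Nonessential monotonic enhancements -/

/-- Activating a nonessential monotonic enhancement at finitely many sites does not create
doubly-infinite self-repelling paths. Monotonicity allows the activation of the sites one by one,
each of them being activated in the configuration enhanced at the previous ones. -/
lemma Enhancement.hasDoublyInfinitePath_of_enhanced {L : Lattice} {E : Enhancement L}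
    (hmono : E.Monotonic) (hness : ¬ E.Essential) {ω : Set Site} {A : Set Site} (hA : A.Finite)
    (h : HasDoublyInfinitePath L (E.enhanced ω A)) : HasDoublyInfinitePath L ω := by
  induction A, hA using Set.Finite.induction_on with
  | empty => simpa [Enhancement.enhanced] using h
  | @insert a A _ _ ih =>
    refine ih ?_
    by_contra hcon
    refine hness ⟨a, E.enhanced ω A, hcon, h.mono ?_⟩
    rintro y (hy | hy)
    · exact Or.inl (Or.inl hy)
    · simp only [mem_iUnion, mem_insert_iff] at hy
      obtain ⟨x, rfl | hx, hy⟩ := hy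
      · exact Or.inr (hmono x ω _ subset_union_left hy)
      · exact Or.inl (Or.inr (mem_biUnion hx hy))

/-! ### Crossings and their stability under enhancements -/

lemma mem_uIcc_of_mem_segment {u v p : EuclideanSpace ℝ (Fin 2)} (hp : p ∈ segment ℝ u v)
    (i : Fin 2) : p i ∈ uIcc (u i) (v i) := by
  rw [← segment_eq_uIcc]
  have := mem_image_of_mem (EuclideanSpace.proj (𝕜 := ℝ) i).toLinearMap.toAffineMap hp
  rwa [image_segment] at this

lemma exists_mem_segment_of_mem_uIcc {u v : EuclideanSpace ℝ (Fin 2)} {c : ℝ} {i : Fin 2}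
    (hc : c ∈ uIcc (u i) (v i)) : ∃ p ∈ segment ℝ u v, p i = c := by
  rw [← segment_eq_uIcc] at hc
  have := image_segment ℝ (EuclideanSpace.proj (𝕜 := ℝ) i).toLinearMap.toAffineMap u v
  exact this.symm.subset hc

lemma segment_inter_hside_nonempty {u v : EuclideanSpace ℝ (Fin 2)} {b c : ℝ}
    (hu : |u 0| < b / 2) (hv : |v 0| < b / 2) (hc : c ≤ u 1) (hc' : v 1 ≤ c) :
    (segment ℝ u v ∩ hside b c).Nonempty := by
  obtain ⟨p, hp, hpc⟩ := exists_mem_segment_of_mem_uIcc (u := u) (v := v) (i := 1)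
    (mem_uIcc.2 (Or.inr ⟨hc', hc⟩))
  have hp0 := mem_uIcc.1 (mem_uIcc_of_mem_segment hp 0)
  rw [abs_lt] at hu hv
  refine ⟨p, hp, ?_, ?_, hpc⟩ <;> rcases hp0 with h | h <;> linarith [h.1, h.2]

lemma Lattice.abs_smul_pos_sub_le (L : Lattice) {δ : ℝ} (hδ : 0 < δ) {x y : Site}
    (h : L.graph.Adj x y) (k : Fin 2) : |(δ • L.pos x) k - (δ • L.pos y) k| ≤ δ := by
  have := L.abs_pos_sub_le h k
  simp only [PiLp.smul_apply, smul_eq_mul]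
  rw [← mul_sub, abs_mul, abs_of_pos hδ]
  nlinarith

lemma Lattice.abs_smul_pos_le_of_inter_hside (L : Lattice) {δ : ℝ} (hδ : 0 < δ) {x y : Site}
    (h : L.graph.Adj x y) {b c : ℝ}
    (hs : (segment ℝ (δ • L.pos x) (δ • L.pos y) ∩ hside b c).Nonempty) :
    (|(δ • L.pos x) 0| ≤ b / 2 + δ ∧ |(δ • L.pos x) 1 - c| ≤ δ) ∧
      (|(δ • L.pos y) 0| ≤ b / 2 + δ ∧ |(δ • L.pos y) 1 - c| ≤ δ) := by
  obtain ⟨p, hp, h1, h2, rfl⟩ := hs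
  have a0 := abs_le.1 (L.abs_smul_pos_sub_le hδ h 0)
  have a1 := abs_le.1 (L.abs_smul_pos_sub_le hδ h 1)
  have p0 := mem_uIcc.1 (mem_uIcc_of_mem_segment hp 0)
  have p1 := mem_uIcc.1 (mem_uIcc_of_mem_segment hp 1)
  simp only [abs_le]
  refine ⟨⟨⟨?_, ?_⟩, ?_, ?_⟩, ⟨?_, ?_⟩, ?_, ?_⟩ <;> rcases p0 with p0 | p0 <;>
    rcases p1 with p1 | p1 <;> linarith [p0.1, p0.2, p1.1, p1.2, a0.1, a0.2, a1.1, a1.2]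

/-- A path from above a rectangle to below it contains a crossing of the rectangle if its sites in a
neighbourhood of the horizontal strip spanned by the rectangle are open and in the vertical strip
spanned by it. -/
lemma hasVerticalCrossing_of_path {L : Lattice} {δ b h : ℝ} {ω : Set Site} (hδ : 0 < δ)
    (hh : 0 < h) {n : ℕ} {z : ℕ → Site} (hadj : ∀ j < n, L.graph.Adj (z j) (z (j + 1)))
    (h0 : h / 2 ≤ (δ • L.pos (z 0)) 1) (hn : (δ • L.pos (z n)) 1 ≤ -(h / 2))
    (hω : ∀ j ≤ n, |(δ • L.pos (z j)) 1| < h / 2 + 2 * δ → z j ∈ ω ∧ |(δ • L.pos (z j)) 0| < b / 2) :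
    HasVerticalCrossing L δ b h ω := by
  classical
  -- `q` is the first site of the path below the rectangle, `p` is the last site above it before `q`.
  have hex : ∃ q, (δ • L.pos (z q)) 1 ≤ -(h / 2) := ⟨n, hn⟩
  obtain ⟨q, hq, hqmin⟩ : ∃ q, (δ • L.pos (z q)) 1 ≤ -(h / 2) ∧
      ∀ j < q, -(h / 2) < (δ • L.pos (z j)) 1 :=
    ⟨Nat.find hex, Nat.find_spec hex, fun j hj => not_le.1 (Nat.find_min hex hj)⟩
  have hqn : q ≤ n := by
    by_contra! hlt
    exact (hqmin n hlt).not_ge hn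
  obtain ⟨p, hpq, hp, hpmax⟩ : ∃ p ≤ q, h / 2 ≤ (δ • L.pos (z p)) 1 ∧
      ∀ j, p < j → j ≤ q → (δ • L.pos (z j)) 1 < h / 2 :=
    ⟨Nat.findGreatest (fun j => h / 2 ≤ (δ • L.pos (z j)) 1) q, Nat.findGreatest_le _,
      Nat.findGreatest_spec (P := fun j => h / 2 ≤ (δ • L.pos (z j)) 1) (Nat.zero_le q) h0,
      fun j hj hjq => not_le.1 (Nat.findGreatest_is_greatest hj hjq)⟩
  have hpq' : p < q := by
    refine lt_of_le_of_ne hpq ?_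
    rintro rfl
    linarith
  have hnear : ∀ j, p ≤ j → j ≤ q → |(δ • L.pos (z j)) 1| < h / 2 + 2 * δ := by
    intro j hpj hjq
    rw [abs_lt]
    constructor
    · rcases hjq.lt_or_eq with hlt | rfl
      · linarith [hqmin j hlt]
      · have h1 := hqmin (j - 1) (by omega)
        have h2 := abs_le.1 (L.abs_smul_pos_sub_le hδ (hadj (j - 1) (by omega)) 1)
        rw [Nat.sub_add_cancel (by omega)] at h2
        linarith [h2.2]
    · rcases hpj.lt_or_eq with hlt | rfl
      · linarith [hpmax j hlt hjq]
      · have h1 := hpmax (p + 1) (by omega) (by omega)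
        have h2 := abs_le.1 (L.abs_smul_pos_sub_le hδ (hadj p (by omega)) 1)
        linarith [h2.2]
  obtain ⟨m, rfl⟩ : ∃ m, q = p + (m + 1) := ⟨q - p - 1, by omega⟩
  have hmem : ∀ j ≤ m + 1, z (p + j) ∈ ω ∧ |(δ • L.pos (z (p + j))) 0| < b / 2 := fun j hj =>
    hω (p + j) (by omega) (hnear _ (by omega) (by omega))
  refine ⟨m, fun j => z (p + j), fun j hj => hadj _ (by omega), fun j hj => (hmem j hj).1,
    fun j hj hjm => ?_, ?_, ?_⟩
  · have := abs_lt.1 (hmem j (by omega)).2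
    exact ⟨this.1, this.2, hqmin _ (by omega), hpmax _ (by omega) (by omega)⟩
  · exact segment_inter_hside_nonempty (hmem 0 (by omega)).2 (hmem 1 (by omega)).2 hp
      (hpmax _ (by omega) (by omega)).le
  · exact segment_inter_hside_nonempty (hmem m (by omega)).2 (hmem (m + 1) le_rfl).2
      (hqmin _ (by omega)).le hq

/-- If a nonessential monotonic enhancement of `ω` crosses a rectangle, then `ω` crosses any slightly
wider and lower rectangle, provided that the mesh is small. The sites of `ω` close to the rectangle,
together with rays going up and down from the ends of the crossing, form a configuration that
contains a doubly-infinite self-repelling path once it is enhanced, hence also before. In units of the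
mesh, the sites that matter are at distance at most `1` from the rectangle for the crossing itself,
and `2 * R` further for the sites on which the enhancement that opens a site of it depends. -/
lemma hasVerticalCrossing_of_enhanced {L : Lattice} {E : Enhancement L} (hmono : E.Monotonic)
    (hness : ¬ E.Essential) {R : ℝ} (hR0 : 0 ≤ R)
    (hR : ∀ x : Site,
      (∀ ω ω' : Set Site, (∀ y, dist (L.pos y) (L.pos x) ≤ R → (y ∈ ω ↔ y ∈ ω')) →
        E.φ x ω = E.φ x ω') ∧
      ∀ ω : Set Site, ∀ y ∈ E.φ x ω, dist (L.pos y) (L.pos x) ≤ R)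
    {δ b h b' h' : ℝ} (hδ : 0 < δ) (hh' : 0 < h') (hb : δ * (2 * R + 3) < (b' - b) / 2)
    (hh : δ * (2 * R + 3) < (h - h') / 2) {ω α : Set Site}
    (hcross : HasVerticalCrossing L δ b h (E.enhanced ω α)) :
    HasVerticalCrossing L δ b' h' ω := by
  obtain ⟨m, x, hadj, hxω, hrect, htop, hbot⟩ := hcross
  have hδR : 0 ≤ δ * R := by positivity
  obtain ⟨⟨t00, t01⟩, -⟩ := L.abs_smul_pos_le_of_inter_hside hδ (hadj 0 (by omega)) htop
  obtain ⟨-, ⟨b00, b01⟩⟩ := L.abs_smul_pos_le_of_inter_hside hδ (hadj m le_rfl) hbot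
  have hx : ∀ j ≤ m + 1, |(δ • L.pos (x j)) 0| ≤ b / 2 + δ ∧ |(δ • L.pos (x j)) 1| ≤ h / 2 + δ := by
    intro j hj
    rcases Nat.eq_zero_or_pos j with rfl | hj0
    · refine ⟨t00, ?_⟩
      rw [abs_le] at t01 ⊢
      constructor <;> linarith [t01.1, t01.2]
    rcases hj.lt_or_eq with hlt | rfl
    · obtain ⟨h1, h2, h3, h4⟩ := hrect j hj0 (by omega)
      simp only [abs_le]
      refine ⟨⟨?_, ?_⟩, ?_, ?_⟩ <;> linarith
    · refine ⟨b00, ?_⟩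
      rw [abs_le] at b01 ⊢
      constructor <;> linarith [b01.1, b01.2]
  set K : Set Site := {y | |(δ • L.pos y) 0| < b' / 2 ∧ |(δ • L.pos y) 1| < h} with hK
  have hKfin : K.Finite := by
    refine (L.finite_setOf_abs_pos_le (b' / 2 / δ) (h / δ)).subset ?_
    rintro y ⟨h0, h1⟩
    simp only [PiLp.smul_apply, smul_eq_mul, abs_mul, abs_of_pos hδ] at h0 h1
    exact ⟨by rw [le_div_iff₀ hδ]; linarith, by rw [le_div_iff₀ hδ]; linarith⟩
  have hxK : ∀ j ≤ m + 1, ∀ y, dist (L.pos y) (L.pos (x j)) ≤ 2 * R → y ∈ K := by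
    intro j hj y hy
    have key : ∀ k, |(δ • L.pos y) k - (δ • L.pos (x j)) k| ≤ δ * (2 * R) := by
      intro k
      have h1 := (PiLp.norm_apply_le (L.pos y - L.pos (x j)) k).trans ((dist_eq_norm _ _).symm.trans_le hy)
      simp only [PiLp.smul_apply, smul_eq_mul, PiLp.sub_apply, Real.norm_eq_abs] at h1 ⊢
      rw [← mul_sub, abs_mul, abs_of_pos hδ]
      exact mul_le_mul_of_nonneg_left h1 hδ.le
    obtain ⟨hj0, hj1⟩ := hx j hj
    have k0 := abs_le.1 (key 0)
    have k1 := abs_le.1 (key 1)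
    rw [abs_le] at hj0 hj1
    refine ⟨abs_lt.2 ⟨?_, ?_⟩, abs_lt.2 ⟨?_, ?_⟩⟩ <;>
      linarith [hj0.1, hj0.2, hj1.1, hj1.2, k0.1, k0.2, k1.1, k1.2]
  set ω' : Set Site := (ω ∩ K) ∪ range (fun n => L.up^[n] (x 0)) ∪
    range (fun n => L.down^[n] (x (m + 1))) with hω'
  have hωK : ω ∩ K ⊆ ω' := fun y hy => Or.inl (Or.inl hy)
  have hloc : ∀ j, ∃ a, j ≤ m + 1 → x j ∈ ω' ∨ x j ∈ E.φ a ω' := by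
    intro j
    by_cases hj : j ≤ m + 1
    · rcases hxω j hj with hmem | hmem
      · exact ⟨0, fun _ => Or.inl (hωK ⟨hmem, hxK j hj _ (by simpa using hR0)⟩)⟩
      · simp only [mem_iUnion] at hmem
        obtain ⟨a, -, hmem⟩ := hmem
        refine ⟨a, fun _ => Or.inr (hmono a _ _ hωK ?_)⟩
        rwa [← (hR a).1 ω (ω ∩ K)]
        refine fun y hy => ⟨fun hyω => ⟨hyω, hxK j hj y ?_⟩, fun h => h.1⟩
        have := (hR a).2 ω (x j) hmem
        linarith [dist_triangle_right (L.pos y) (L.pos (x j)) (L.pos a)]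
    · exact ⟨0, fun h => (hj h).elim⟩
  choose a ha using hloc
  have hdip : HasDoublyInfinitePath L ω' := by
    refine Enhancement.hasDoublyInfinitePath_of_enhanced hmono hness
      ((finite_Iic (m + 1)).image a) (hasDoublyInfinitePath_of_path L (n := m + 1)
        (fun j hj => hadj j (by omega)) (fun j hj => ?_) (fun n => Or.inl (Or.inl (Or.inr ⟨n, rfl⟩)))
        (fun n => Or.inl (Or.inr ⟨n, rfl⟩)))
    rcases ha j hj with h | h
    · exact Or.inl h
    · exact Or.inr (mem_biUnion ⟨j, hj, rfl⟩ h)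
  have hup : ∀ n, h / 2 - δ ≤ (δ • L.pos (L.up^[n] (x 0))) 1 := by
    intro n
    have h1 := mul_le_mul_of_nonneg_left (L.pos_le_pos_iterate_up (x 0) n) hδ.le
    have h2 := abs_le.1 t01
    simp only [PiLp.smul_apply, smul_eq_mul] at h2 ⊢
    linarith [h2.1]
  have hdown : ∀ n, (δ • L.pos (L.down^[n] (x (m + 1)))) 1 ≤ -(h / 2 - δ) := by
    intro n
    have h1 := mul_le_mul_of_nonneg_left (L.pos_iterate_down_le_pos (x (m + 1)) n) hδ.le
    have h2 := abs_le.1 b01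
    simp only [PiLp.smul_apply, smul_eq_mul] at h2 ⊢
    linarith [h2.2]
  obtain ⟨n, z, hz, hzmem, ⟨i, hi⟩, ⟨k, hk⟩⟩ := hdip.exists_path (hKfin.subset inter_subset_right)
  refine hasVerticalCrossing_of_path hδ hh' hz ?_ ?_ ?_
  · rw [← hi]
    linarith [hup i]
  · rw [← hk]
    linarith [hdown k]
  · intro j hj hjh
    rw [abs_lt] at hjh
    rcases hzmem j hj with (hmem | ⟨i, hi⟩) | ⟨i, hi⟩
    · exact ⟨hmem.1, hmem.2.1⟩
    · rw [← hi] at hjh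
      linarith [hup i, hjh.2]
    · rw [← hi] at hjh
      linarith [hdown i, hjh.1]

/-! ### Comparison of the crossing probabilities -/

instance (p : I) : IsProbabilityMeasure (sitePercolation p) := by
  unfold sitePercolation; infer_instance

lemma HasVerticalCrossing.mono {L : Lattice} {δ b h : ℝ} {ω ω' : Set Site} (hω : ω ⊆ ω')
    (hc : HasVerticalCrossing L δ b h ω) : HasVerticalCrossing L δ b h ω' := by
  obtain ⟨m, x, hadj, hmem, hc⟩ := hc
  exact ⟨m, x, hadj, fun j hj => hω (hmem j hj), hc⟩

/-- The crossing probability, computed in the space that carries the activated sites as well. -/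
lemma crossingProb_eq_prod (L : Lattice) (s : I) (δ b h : ℝ) :
    crossingProb L δ b h = ((sitePercolation (criticalProb L)).prod (sitePercolation s)).real
      {c | HasVerticalCrossing L δ b h c.1} := by
  have : {c : Set Site × Set Site | HasVerticalCrossing L δ b h c.1} =
      {ω | HasVerticalCrossing L δ b h ω} ×ˢ univ := by
    ext c; simp
  rw [this, measureReal_prod_prod, probReal_univ, mul_one, crossingProb]

lemma crossingProb_le_enhancedCrossingProb (L : Lattice) (E : Enhancement L) (s : I) (δ b h : ℝ) :
    crossingProb L δ b h ≤ enhancedCrossingProb L E s δ b h := by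
  rw [crossingProb_eq_prod L s]
  exact measureReal_mono fun c hc => HasVerticalCrossing.mono subset_union_left hc

lemma eventually_enhancedCrossingProb_le {L : Lattice} {E : Enhancement L} (hmono : E.Monotonic)
    (hness : ¬ E.Essential) (s : I) {b h b' h' : ℝ} (hh' : 0 < h') (hb : b < b') (hh : h' < h) :
    ∀ᶠ δ in 𝓝[>] 0, enhancedCrossingProb L E s δ b h ≤ crossingProb L δ b' h' := by
  obtain ⟨R₀, hR₀⟩ := E.exists_range
  set R := max R₀ 0
  have hR : ∀ x : Site,
      (∀ ω ω' : Set Site, (∀ y, dist (L.pos y) (L.pos x) ≤ R → (y ∈ ω ↔ y ∈ ω')) →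
        E.φ x ω = E.φ x ω') ∧
      ∀ ω : Set Site, ∀ y ∈ E.φ x ω, dist (L.pos y) (L.pos x) ≤ R := fun x =>
    ⟨fun ω ω' h => (hR₀ x).1 ω ω' fun y hy => h y (hy.trans (le_max_left _ _)),
      fun ω y hy => ((hR₀ x).2 ω y hy).trans (le_max_left _ _)⟩
  have hsmall : ∀ c : ℝ, 0 < c → ∀ᶠ δ in 𝓝[>] (0 : ℝ), δ * (2 * R + 3) < c := by
    intro c hc
    have : Tendsto (fun δ : ℝ => δ * (2 * R + 3)) (𝓝[>] 0) (𝓝 0) := by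
      have : Tendsto (fun δ : ℝ => δ * (2 * R + 3)) (𝓝 0) (𝓝 (0 * (2 * R + 3))) :=
        (continuous_mul_const _).tendsto 0
      rw [zero_mul] at this
      exact this.mono_left nhdsWithin_le_nhds
    exact this.eventually_lt_const hc
  filter_upwards [self_mem_nhdsWithin, hsmall ((b' - b) / 2) (by linarith),
    hsmall ((h - h') / 2) (by linarith)] with δ hδ h1 h2
  rw [crossingProb_eq_prod L s]
  exact measureReal_mono fun c hc =>
    hasVerticalCrossing_of_enhanced hmono hness (le_max_right _ _) hR hδ hh' h1 h2 hc

end EnhPerc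

theorem mainTheorem9 (L : EnhPerc.Lattice) (F : ℝ → ℝ)
    (hF : ContinuousOn F (Set.Ioi 0))
    (hlim : ∀ b h : ℝ, 0 < b → 0 < h →
      Filter.Tendsto (fun δ => EnhPerc.crossingProb L δ b h) (nhdsWithin 0 (Set.Ioi 0))
        (nhds (F (b / h))))
    (E : EnhPerc.Enhancement L) (hmono : E.Monotonic) (hness : ¬ E.Essential)
    (s : unitInterval) (b h : ℝ) (hb : 0 < b) (hh : 0 < h) :
    Filter.Tendsto (fun δ => EnhPerc.enhancedCrossingProb L E s δ b h)
      (nhdsWithin 0 (Set.Ioi 0)) (nhds (F (b / h))) := by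
  refine tendsto_order.2 ⟨fun c hc => ?_, fun c hc => ?_⟩
  · filter_upwards [(hlim b h hb hh).eventually_const_lt hc] with δ hδ
    exact hδ.trans_le (EnhPerc.crossingProb_le_enhancedCrossingProb L E s δ b h)
  · -- By continuity, `F` is still below `c` at the aspect ratio of a slightly wider and lower
    -- rectangle.
    have hcont : ContinuousAt (fun η : ℝ => F ((b + η) / (h - η))) 0 := by
      refine ContinuousAt.comp (g := F) ?_ ?_
      · simpa using hF.continuousAt (Ioi_mem_nhds (div_pos hb hh))
      · exact ContinuousAt.div (by fun_prop) (by fun_prop) (by simpa using hh.ne')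
    have hev : ∀ᶠ η in 𝓝[>] (0 : ℝ), F ((b + η) / (h - η)) < c :=
      (hcont.eventually_lt_const (by simpa using hc)).filter_mono nhdsWithin_le_nhds
    have hevh : ∀ᶠ η in 𝓝[>] (0 : ℝ), η < h :=
      (eventually_lt_nhds hh).filter_mono nhdsWithin_le_nhds
    obtain ⟨η, hη, hηh, hη0⟩ := (hev.and (hevh.and self_mem_nhdsWithin)).exists
    have hη0 : 0 < η := hη0
    filter_upwards [(hlim (b + η) (h - η) (by linarith) (by linarith)).eventually_lt_const hη,
      EnhPerc.eventually_enhancedCrossingProb_le (L := L) hmono hness s (b := b) (h := h)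
        (b' := b + η) (h' := h - η) (by linarith) (by linarith) (by linarith)] with δ h1 h2
    exact h2.trans_lt h1
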